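/- All algebras are finite-dimensional associative algebras over $\mathbb{C}$, not necessarily unital; the dual space $\mathfrak{A}^*$ of linear functionals carries its Euclidean topology. For $F\in\mathfrak{A}^*$ and $\alpha\in\mathbb{C}$ let $\mathrm{Stab}_F(\alpha)=\{a\in\mathfrak{A} : F(ax)=\alpha F(xa)\ \text{for all } x\in\mathfrak{A}\}$. Let $A_F=(F(e_ie_j))_{i,j}$ in a basis $(e_i)$ of $\mathfrak{A}$, and let $\chi_F(\lambda,\mu)=\det(\lambda A_F+\mu A_F^T)\in\mathbb{C}[\lambda,\mu]$ be the characteristic polynomial, defined up to a nonzero constant factor. A root of $\chi_F$ is an $\alpha\in\mathbb{C}\cup\{\infty\}$ with $\chi_F(1,-\alpha)=0$ if $\alpha$ is finite, respectively $\chi_F(0,1)=0$ if $\alpha=\infty$. The algebra $\mathfrak{A}$ is of type 1 if $\chi_F\neq 0$ for all $F$ in some non-empty open subset of $\mathfrak{A}^*$. It is $1$-precise if for all $F$ in some open dense subset of $\mathfrak{A}^*$ the dimension of $\mathrm{Stab}_F(1)$ is exactly the highest power of $\lambda+\mu$ that divides $\chi_F$. The index $\mathrm{ind}\,\mathfrak{A}$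 is $\dim\mathrm{Stab}_F(1)$ for any $1$-regular $F$, that is, any $F$ such that $\dim\mathrm{Stab}_F(1)\le\dim\mathrm{Stab}_G(1)$ for all $G$ in a neighbourhood of $F$; this number does not depend on $F$ and is the index of the Lie algebra $\mathfrak{A}$ with bracket $[a,b]=ab-ba$. **Theorem (index of tensor products).** Let $\mathfrak{A}$ and $\mathfrak{B}$ be two $1$-precise algebras of type 1. Suppose that every root of the characteristic polynomial of $\mathfrak{A}$ other than $1$ (including $0$ and $\infty$) depends non-trivially on $F$: no $\alpha\in\mathbb{C}\cup\{\infty\}$ with $\alpha\neq 1$ is a root of $\chi_F$ for all $F$ in a non-empty open subset of $\mathfrak{A}^*$. Then $\mathfrak{A}\otimes_{\mathbb{C}}\mathfrak{B}$ is of type 1 and $1$-precise, and $\mathrm{ind}(\mathfrak{A}\otimes\mathfrak{B})=\mathrm{ind}\,\mathfrak{A}\cdot\mathrm{ind}\,\mathfrak{B}$. -/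

import Mathlib

open scoped TensorProduct Topology

noncomputable section

namespace AssocIndex

section Basic

variable {A : Type*} [NonUnitalRing A] [Module ℂ A] [SMulCommClass ℂ A A] [IsScalarTower ℂ A A]

/-- The stabilizer `Stab_F(α)`, consisting of all `a` with `F (a x) - α F (x a) = 0` for all `x`. -/
def Stab (F : Module.Dual ℂ A) (α : ℂ) : Submodule ℂ A where
  carrier := {a | ∀ x : A, F (a * x) - α * F (x * a) = 0}
  add_mem' := by
    intro a b ha hb x
    have h1 := ha x
    have h2 := hb x
    simp only [add_mul, mul_add, map_add]
    linear_combination h1 + h2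
  zero_mem' := by
    intro x
    simp
  smul_mem' := by
    intro c a ha x
    have h1 := ha x
    simp only [smul_mul_assoc, mul_smul_comm, map_smul, smul_eq_mul]
    linear_combination c * h1

/-- The matrix `A_F = (F (e_i e_j))` of the bilinear form `(x, y) ↦ F (x y)` in a basis `e`. -/
def formMatrix {ι : Type*} (e : Module.Basis ι ℂ A) (F : Module.Dual ℂ A) : Matrix ι ι ℂ :=
  Matrix.of fun i j => F (e i * e j)

/-- The characteristic polynomial `det (λ A_F + μ A_Fᵀ)` in a basis `e`; the variable `X 0` is `λ`
and the variable `X 1` is `μ`. -/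
def charPolyIn {ι : Type*} [Fintype ι] [DecidableEq ι] (e : Module.Basis ι ℂ A)
    (F : Module.Dual ℂ A) : MvPolynomial (Fin 2) ℂ :=
  Matrix.det
    ((MvPolynomial.X 0 : MvPolynomial (Fin 2) ℂ) • (formMatrix e F).map MvPolynomial.C +
      (MvPolynomial.X 1 : MvPolynomial (Fin 2) ℂ) • (formMatrix e F).transpose.map MvPolynomial.C)

variable [FiniteDimensional ℂ A]

/-- The characteristic polynomial `χ_F(λ, μ)` of the whole algebra. A change of basis multiplies it
by a nonzero constant, so that a fixed basis is used. -/
def charPoly (F : Module.Dual ℂ A) : MvPolynomial (Fin 2) ℂ :=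
  charPolyIn (Module.finBasis ℂ A) F

/-- `F` is `α`-precise: `dim Stab_F(α)` is the exact power of the linear form `α λ + μ` in `χ_F`
(this is the linear form that vanishes at `(λ, μ) = (1, -α)`, where `λ A_F + μ A_Fᵀ` becomes
`A_F - α A_Fᵀ`). In particular `χ_F ≠ 0`. -/
def IsPrecise (α : ℂ) (F : Module.Dual ℂ A) : Prop :=
  emultiplicity (MvPolynomial.C α * MvPolynomial.X 0 + MvPolynomial.X 1) (charPoly F) =
    (Module.finrank ℂ (Stab F α) : ℕ∞)

/-- `α` in `ℂ ∪ {∞}` is a root of `χ_F`: for finite `α` this says `χ_F(1, -α) = 0`, that is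
`det (A_F - α A_Fᵀ) = 0`; for `α = ∞` it says `χ_F(0, 1) = 0`, that is `det A_Fᵀ = 0`. -/
def IsCharRoot (F : Module.Dual ℂ A) : OnePoint ℂ → Prop
  | none => MvPolynomial.eval ![0, 1] (charPoly F) = 0
  | some α => MvPolynomial.eval ![1, -α] (charPoly F) = 0

end Basic

section Generic

variable (A : Type*) [NonUnitalRing A] [Module ℂ A] [SMulCommClass ℂ A A] [IsScalarTower ℂ A A]

/-- The Euclidean topology on the dual of a finite-dimensional space, realised as the topology of
pointwise convergence (in finite dimension there is only one Hausdorff vector space topology). -/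
@[reducible] def dualTopology : TopologicalSpace (Module.Dual ℂ A) :=
  TopologicalSpace.induced (fun (F : Module.Dual ℂ A) (a : A) => F a) inferInstance

attribute [local instance] dualTopology

variable {A} in
/-- `F` is `α`-regular: `dim Stab(α)` is minimal at `F` among functionals in a neighbourhood. -/
def IsRegular (α : ℂ) (F : Module.Dual ℂ A) : Prop :=
  ∀ᶠ G in 𝓝 F, Module.finrank ℂ (Stab F α) ≤ Module.finrank ℂ (Stab G α)

/-- Regular functionals exist. -/
theorem exists_isRegular (α : ℂ) : ∃ F : Module.Dual ℂ A, IsRegular α F := by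
  let d : Module.Dual ℂ A → ℕ := fun F => Module.finrank ℂ (Stab F α)
  exact ⟨Function.argmin d, Filter.Eventually.of_forall fun G => Function.argmin_le d G⟩

/-- The index of `A`: the dimension of `Stab_F(1)` for a `1`-regular functional `F`. -/
def index : ℕ :=
  Module.finrank ℂ (Stab (exists_isRegular A 1).choose 1)

variable [FiniteDimensional ℂ A]

/-- `dim Stab_F(α)` at an `α`-regular `F` is the minimum over all functionals. -/
theorem IsRegular.finrank_le {α : ℂ} {F : Module.Dual ℂ A} (hF : IsRegular α F)
    (G : Module.Dual ℂ A) :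
    Module.finrank ℂ (Stab F α) ≤ Module.finrank ℂ (Stab G α) := by
  -- the map `a ↦ (x ↦ H (a x) - α H (x a))`, linear in `H`, with kernel `Stab_H(α)`
  let T : Module.Dual ℂ A →ₗ[ℂ] A →ₗ[ℂ] Module.Dual ℂ A :=
    LinearMap.mk₂ ℂ (fun H a => H ∘ₗ (LinearMap.mul ℂ A a) - α • H ∘ₗ (LinearMap.mul ℂ A).flip a)
      (by intros; ext; simp; ring) (by intros; ext; simp; ring)
      (by intros; ext; simp; ring) (by intros; ext; simp; ring)
  have hT : ∀ H, LinearMap.ker (T H) = Stab H α := by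
    intro H
    ext a
    rw [LinearMap.mem_ker, LinearMap.ext_iff]
    rfl
  obtain ⟨W, hW⟩ := (Stab G α).exists_isCompl
  have hinj : LinearMap.ker (T G ∘ₗ W.subtype) = ⊥ := by
    rw [LinearMap.ker_comp, hT, ← Submodule.disjoint_iff_comap_eq_bot]
    exact hW.symm.disjoint
  obtain ⟨L, hL⟩ := LinearMap.exists_leftInverse_of_injective _ hinj
  let e := Module.finBasis ℂ W
  let M : Module.Dual ℂ A → Matrix _ _ ℂ := fun H =>
    LinearMap.toMatrix e e (L ∘ₗ T H ∘ₗ W.subtype)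
  have key : ∀ H, (M H).det ≠ 0 →
      Module.finrank ℂ (Stab H α) ≤ Module.finrank ℂ (Stab G α) := by
    intro H hH
    have hd : Disjoint W (Stab H α) := by
      rw [← hT, Submodule.disjoint_iff_comap_eq_bot, ← LinearMap.ker_comp, LinearMap.ker_eq_bot]
      have hu : IsUnit (LinearMap.det (L ∘ₗ T H ∘ₗ W.subtype)) := by
        rw [← LinearMap.det_toMatrix e]
        exact isUnit_iff_ne_zero.mpr hH
      have hb : Function.Injective (L ∘ₗ T H ∘ₗ W.subtype) :=
        ((Module.End.isUnit_iff _).mp ((LinearMap.isUnit_iff_isUnit_det _).mpr hu)).injective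
      exact Function.Injective.of_comp (f := L) hb
    have h1 := Submodule.finrank_add_finrank_le_of_disjoint hd
    have h2 := Submodule.finrank_add_eq_of_isCompl hW
    omega
  let p : Polynomial ℂ := Matrix.det
    ((M F).map Polynomial.C + (Polynomial.X : Polynomial ℂ) • (M (G - F)).map Polynomial.C)
  have hp : ∀ t : ℂ, p.eval t = (M (F + t • (G - F))).det := by
    intro t
    rw [← Polynomial.coe_evalRingHom, RingHom.map_det]
    congr 1
    ext i j
    simp [M, LinearMap.comp_add, LinearMap.add_comp, LinearMap.comp_smul, LinearMap.smul_comp,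
      LinearMap.comp_sub, LinearMap.sub_comp]
  have hp0 : p ≠ 0 := by
    intro h
    have h1 := hp 1
    rw [h] at h1
    have h2 : M G = 1 := by
      simp only [M, hL, LinearMap.toMatrix_id]
    simp [h2] at h1
  have hcont : Continuous fun t : ℂ => F + t • (G - F) := by
    refine continuous_induced_rng.mpr (continuous_pi fun a => ?_)
    simp only [Function.comp_def, LinearMap.add_apply, LinearMap.smul_apply, smul_eq_mul]
    fun_prop
  have hev : ∀ᶠ t : ℂ in 𝓝[≠] 0, Module.finrank ℂ (Stab F α) ≤
      Module.finrank ℂ (Stab (F + t • (G - F)) α) := by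
    have h := hcont.tendsto 0
    simp only [zero_smul, add_zero] at h
    exact (h.eventually hF).filter_mono nhdsWithin_le_nhds
  have hev2 : ∀ᶠ t : ℂ in 𝓝[≠] 0, p.eval t ≠ 0 := by
    have hfin : {t : ℂ | p.eval t = 0}.Finite := by
      have := p.finite_setOfPred_isRoot hp0
      exact this
    have h3 : ({t : ℂ | p.eval t = 0} \ {0}).Finite := hfin.subset Set.sdiff_subset
    have h4 : ({t : ℂ | p.eval t = 0} \ {0})ᶜ ∈ 𝓝 (0 : ℂ) :=
      h3.isClosed.isOpen_compl.mem_nhds (by simp)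
    filter_upwards [mem_nhdsWithin_of_mem_nhds h4, self_mem_nhdsWithin] with t ht ht0 hpt
    exact ht ⟨hpt, ht0⟩
  obtain ⟨t, ht1, ht2⟩ := (hev.and hev2).exists
  rw [hp] at ht2
  exact ht1.trans (key _ ht2)

/-- The index does not depend on the choice of the `1`-regular functional. -/
theorem IsRegular.finrank_eq_index {F : Module.Dual ℂ A} (hF : IsRegular 1 F) :
    Module.finrank ℂ (Stab F 1) = index A :=
  le_antisymm (hF.finrank_le A _) ((exists_isRegular A 1).choose_spec.finrank_le A F)

/-- `A` is type 1: `χ_F` is not the zero polynomial for all `F` in some nonempty open set. -/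
def IsType1 : Prop :=
  ∃ U : Set (Module.Dual ℂ A), IsOpen U ∧ U.Nonempty ∧ ∀ F ∈ U, charPoly F ≠ 0

/-- `A` is `α`-precise (for a constant `α`): an open dense set of functionals is `α`-precise. -/
def IsPreciseAlgebra (α : ℂ) : Prop :=
  ∃ U : Set (Module.Dual ℂ A), IsOpen U ∧ Dense U ∧ ∀ F ∈ U, IsPrecise α F

/-- Every root of the characteristic polynomial other than `1` (including `0` and `∞`) depends
non-trivially on `F`: a root that stays constant on a nonempty open set of functionals is `1`. -/
def RootsDependNontrivially : Prop :=
  ∀ (α : OnePoint ℂ) (U : Set (Module.Dual ℂ A)), IsOpen U → U.Nonempty →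
    (∀ F ∈ U, IsCharRoot F α) → α = ((1 : ℂ) : OnePoint ℂ)

end Generic

end AssocIndex

end

/-! The exponent of `λ + μ` in `χ_F` is at least `dim Stab_F(1)`, with equality exactly when the
form `F(xy)` is nondegenerate on `Stab_F(1)` (`exists_charPoly_factor`). So generic `F` on `A` and
`G` on `B` are nondegenerate on their stabilizers, and these are commutative by regularity
(`IsRegular.commute`).

Fix such a `G`. It has finitely many roots, and no root of `A` other than `1` is generically
constant, so `F` can be chosen with `F(xy)` nondegenerate and with no root `α ≠ 1` for which `α⁻¹`
is a root of `G`. Let `S` be the operator with `F(ax) = F(x·Sa)`; its `α`-eigenspace is `Stab_F(α)`.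
An element of the stabilizer of `F ⊗ G` solves a pencil equation in which eigenvalues of `S` must
match inverse roots of `G`. Only the eigenvalue `1` survives, where `S` is semisimple by
nondegeneracy, so `Stab_{F⊗G}(1) = Stab_F(1) ⊗ Stab_G(1)` (`eq_sum_of_mem_Stab_tensorDual`).

This stabilizer is again commutative with nondegenerate form. A slice argument shows that `F ⊗ G` is
then `1`-regular (`NondegOnStab.isRegular`), which gives the index. Since the coefficients of `χ`
are polynomial in the functional, this single functional also yields type 1 and `1`-preciseness. -/

noncomputable section

namespace AssocIndex

/-! ### Multiplicity of `λ + μ` in `χ_F` and nondegeneracy on the stabilizer. -/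

section Precise

variable {A : Type*} [NonUnitalRing A] [Module ℂ A] [SMulCommClass ℂ A A] [IsScalarTower ℂ A A]

/-- The bilinear form `(x, y) ↦ F (x y)`. -/
def mulForm (F : Module.Dual ℂ A) : LinearMap.BilinForm ℂ A := (LinearMap.mul ℂ A).compr₂ F

@[simp]
theorem mulForm_apply (F : Module.Dual ℂ A) (a b : A) : mulForm F a b = F (a * b) := rfl

theorem mem_Stab {F : Module.Dual ℂ A} {α : ℂ} {a : A} :
    a ∈ Stab F α ↔ ∀ x, F (a * x) = α * F (x * a) :=
  forall_congr' fun _ => sub_eq_zero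

theorem mem_Stab_one {F : Module.Dual ℂ A} {a : A} :
    a ∈ Stab F 1 ↔ ∀ x, F (a * x) = F (x * a) := by
  simp [mem_Stab]

/-- The form `F (x y)` is nondegenerate on the stabilizer `Stab_F(1)`. -/
def NondegOnStab (F : Module.Dual ℂ A) : Prop :=
  ∀ c ∈ Stab F 1, (∀ c' ∈ Stab F 1, F (c * c') = 0) → c = 0

theorem mem_Stab_of_basis {ι : Type*} (e : Module.Basis ι ℂ A) {F : Module.Dual ℂ A} {α : ℂ}
    {a : A} (h : ∀ i, F (a * e i) = α * F (e i * a)) : a ∈ Stab F α := by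
  rw [mem_Stab]
  have : mulForm F a = α • (mulForm F).flip a := e.ext fun i => by simpa using h i
  intro x
  simpa using LinearMap.congr_fun this x

theorem charPolyIn_reindex {ι κ : Type*} [Fintype ι] [DecidableEq ι] [Fintype κ] [DecidableEq κ]
    (e : Module.Basis ι ℂ A) (σ : ι ≃ κ) (F : Module.Dual ℂ A) :
    charPolyIn (e.reindex σ) F = charPolyIn e F := by
  unfold charPolyIn
  rw [← Matrix.det_submatrix_equiv_self σ]
  congr 1
  ext i j : 1
  simp [formMatrix]

theorem charPolyIn_associated_of_same_index {ι : Type*} [Fintype ι] [DecidableEq ι]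
    (e e' : Module.Basis ι ℂ A) (F : Module.Dual ℂ A) :
    Associated (charPolyIn e F) (charPolyIn e' F) := by
  have hQ : ∀ b : Module.Basis ι ℂ A,
      formMatrix b F = LinearMap.BilinForm.toMatrix b (mulForm F) := by
    intro b
    ext i j
    simp [formMatrix, LinearMap.BilinForm.toMatrix_apply]
  set P := e.toMatrix e' with hP
  have hPQ : formMatrix e' F = P.transpose * formMatrix e F * P := by
    rw [hQ, hQ, LinearMap.BilinForm.toMatrix_mul_basis_toMatrix]
  have hdet : IsUnit (MvPolynomial.C (σ := Fin 2) P.det) := by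
    have : IsUnit P.det := by
      let _ := e.invertibleToMatrix e'
      exact Matrix.isUnit_det_of_invertible P
    exact this.map MvPolynomial.C
  have key : charPolyIn e' F = charPolyIn e F * (MvPolynomial.C P.det * MvPolynomial.C P.det) := by
    have h1 : ∀ M : Matrix ι ι (MvPolynomial (Fin 2) ℂ),
        M.det * (MvPolynomial.C P.det * MvPolynomial.C P.det) =
          ((P.map MvPolynomial.C).transpose * M * P.map MvPolynomial.C).det := by
      intro M
      rw [Matrix.det_mul, Matrix.det_mul, Matrix.det_transpose, RingHom.map_det,
        RingHom.mapMatrix_apply]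
      ring
    rw [charPolyIn, charPolyIn, h1, hPQ]
    congr 1
    simp only [Matrix.transpose_mul, Matrix.transpose_transpose, Matrix.map_mul, Matrix.mul_add,
      Matrix.add_mul, Matrix.mul_smul, Matrix.smul_mul, Matrix.transpose_map, mul_assoc]
  rw [key]
  exact (associated_mul_unit_right _ _ (hdet.mul hdet))

variable [FiniteDimensional ℂ A]

theorem charPolyIn_associated_charPoly {ι : Type*} [Fintype ι] [DecidableEq ι]
    (e : Module.Basis ι ℂ A) (F : Module.Dual ℂ A) :
    Associated (charPolyIn e F) (charPoly F) := by
  rw [← charPolyIn_reindex e (e.indexEquiv (Module.finBasis ℂ A))]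
  exact charPolyIn_associated_of_same_index _ _ F

/-- The linear form `λ + μ`. -/
abbrev linSum : MvPolynomial (Fin 2) ℂ :=
  MvPolynomial.C 1 * MvPolynomial.X 0 + MvPolynomial.X 1

/-- In a basis adapted to `Stab_F(1)` the polynomial `χ_F` is `(λ + μ) ^ dim Stab_F(1)` times a
factor whose restriction to `λ + μ = 0` decides whether the form is nondegenerate on the
stabilizer. -/
theorem exists_charPoly_factor (F : Module.Dual ℂ A) :
    ∃ (E : MvPolynomial (Fin 2) ℂ) (d : ℂ) (m : ℕ),
      Associated (charPoly F) (linSum ^ Module.finrank ℂ (Stab F 1) * E) ∧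
      linSum ∣ E - MvPolynomial.C d * MvPolynomial.X 0 ^ m ∧ (d ≠ 0 ↔ NondegOnStab F) := by
  obtain ⟨W, hW⟩ := (Stab F 1).exists_isCompl
  let bC := Module.finBasis ℂ (Stab F 1)
  let bW := Module.finBasis ℂ W
  let e := (bC.prod bW).map (Submodule.prodEquivOfIsCompl _ _ hW)
  have hel : ∀ i, e (Sum.inl i) = bC i := by intro i; simp [e]
  have her : ∀ i, e (Sum.inr i) = bW i := by intro i; simp [e]
  have hsym : ∀ i x, F (e (Sum.inl i) * x) = F (x * e (Sum.inl i)) := by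
    intro i x
    rw [hel]
    exact mem_Stab_one.mp (bC i).2 x
  let Q := formMatrix e F
  have hQ : ∀ i j, Q i j = F (e i * e j) := fun _ _ => rfl
  let QC : Matrix _ _ ℂ := Q.submatrix Sum.inl Sum.inl
  let NW : Matrix _ _ ℂ := (Q - Q.transpose).submatrix Sum.inr Sum.inr
  let M : Matrix _ _ (MvPolynomial (Fin 2) ℂ) := Matrix.of fun i j =>
    MvPolynomial.X 0 * MvPolynomial.C (Q i j) + MvPolynomial.X 1 * MvPolynomial.C (Q j i)
  -- For `c` in the stabilizer `F(cx) = F(xc)`, so its row in the pencil is `λ + μ` times a constant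
  -- row. `E` is the pencil with these factors removed.
  let E : Matrix _ _ (MvPolynomial (Fin 2) ℂ) := Matrix.of fun i j =>
    Sum.elim (fun i => MvPolynomial.C (Q (Sum.inl i) j)) (fun i => M (Sum.inr i) j) i
  have hM : charPolyIn e F = M.det := rfl
  have hME : M = Matrix.of fun i j =>
      (Sum.elim (fun _ => linSum) (fun _ => 1) i : MvPolynomial (Fin 2) ℂ) * E i j := by
    ext i j : 1
    rcases i with i | i
    · have : Q j (Sum.inl i) = Q (Sum.inl i) j := (hsym i _).symm
      simp only [linSum, M, E, Matrix.of_apply, Sum.elim_inl, this, map_one, one_mul]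
      ring
    · simp [M, E]
  refine ⟨E.det, QC.det * NW.det, Fintype.card (Fin (Module.finrank ℂ W)), ?_, ?_, ?_⟩
  · refine (charPolyIn_associated_charPoly e F).symm.trans ?_
    rw [hM, hME, Matrix.det_mul_column]
    simp
  · let I := Ideal.span {linSum}
    have h0 : Ideal.Quotient.mk I (MvPolynomial.X 1) = - Ideal.Quotient.mk I (MvPolynomial.X 0) := by
      rw [eq_neg_iff_add_eq_zero, ← map_add, Ideal.Quotient.eq_zero_iff_mem,
        Ideal.mem_span_singleton]
      exact ⟨1, by simp [add_comm]⟩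
    rw [← Ideal.mem_span_singleton, ← Ideal.Quotient.eq_zero_iff_mem, map_sub, sub_eq_zero,
      RingHom.map_det]
    -- Modulo `λ + μ` one has `μ = -λ`: the lower left block vanishes by symmetry, and the lower
    -- right one is `λ` times the commutator form on `W`.
    have : (Ideal.Quotient.mk I).mapMatrix E = Matrix.fromBlocks
        (((Ideal.Quotient.mk I).comp MvPolynomial.C).mapMatrix QC)
        (Matrix.of fun i j => Ideal.Quotient.mk I (E (Sum.inl i) (Sum.inr j))) 0
        (Ideal.Quotient.mk I (MvPolynomial.X 0) •
          ((Ideal.Quotient.mk I).comp MvPolynomial.C).mapMatrix NW) := by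
      ext i j : 1
      rcases i with i | i <;> rcases j with j | j
      · simp [E, QC]
      · simp
      · have : Q (Sum.inr i) (Sum.inl j) = Q (Sum.inl j) (Sum.inr i) := (hsym j _).symm
        simp [E, M, h0, this]
        ring
      · simp [E, M, NW, h0]
        ring
    rw [this, Matrix.det_fromBlocks_zero₂₁, Matrix.det_smul, ← RingHom.map_det, ← RingHom.map_det]
    simp only [RingHom.comp_apply, map_mul, map_pow]
    ring
  -- The commutator form has radical `Stab F 1`, hence is nondegenerate on the complement `W`; only
  -- `QC.det` can vanish.
  · have hNW : NW.det ≠ 0 := by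
      rw [Ne, ← Matrix.exists_vecMul_eq_zero_iff]
      rintro ⟨v, hv0, hv⟩
      have hmem : ((∑ i, v i • bW i : W) : A) ∈ Stab F 1 := by
        refine mem_Stab_of_basis e fun j => ?_
        rcases j with j | j
        · rw [hsym, one_mul]
        · have h1 := congrFun hv j
          simp only [Matrix.vecMul, dotProduct, NW, Matrix.submatrix_apply, Matrix.sub_apply,
            Matrix.transpose_apply, hQ, Pi.zero_apply, mul_sub, Finset.sum_sub_distrib,
            sub_eq_zero] at h1
          simpa [Finset.sum_mul, Finset.mul_sum, her, smul_mul_assoc, mul_smul_comm] using h1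
      have h0 : ((∑ i, v i • bW i : W) : A) = 0 :=
        (Submodule.disjoint_def.mp hW.disjoint) _ hmem (SetLike.coe_mem _)
      apply hv0
      funext i
      exact Fintype.linearIndependent_iff.mp bW.linearIndependent v (by exact_mod_cast h0) i
    rw [mul_ne_zero_iff_right hNW, Ne, ← Matrix.exists_vecMul_eq_zero_iff, NondegOnStab]
    constructor
    · intro h c hc hcc
      by_contra hne
      apply h
      refine ⟨bC.repr ⟨c, hc⟩, ?_, ?_⟩
      · intro h0
        have : bC.repr ⟨c, hc⟩ = 0 := DFunLike.coe_injective h0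
        rw [LinearEquiv.map_eq_zero_iff] at this
        exact hne (congrArg Subtype.val this)
      · funext j
        have h1 := hcc _ (bC j).2
        have h2 : c = ∑ i, bC.repr ⟨c, hc⟩ i • (bC i : A) := by
          have := congrArg (Stab F 1).subtype (bC.sum_repr ⟨c, hc⟩)
          simpa only [map_sum, map_smul, Submodule.subtype_apply] using this.symm
        rw [h2] at h1
        simpa [Matrix.vecMul, dotProduct, QC, hQ, hel, Finset.sum_mul, smul_mul_assoc] using h1
    · rintro h ⟨v, hv0, hv⟩
      apply hv0
      have h0 : ((∑ i, v i • bC i : Stab F 1) : A) = 0 := by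
        refine h _ (SetLike.coe_mem _) fun c hc => ?_
        have h3 : ∀ j, F (((∑ i, v i • bC i : Stab F 1) : A) * bC j) = 0 := by
          intro j
          have h1 := congrFun hv j
          simpa [Matrix.vecMul, dotProduct, QC, hQ, hel, Finset.sum_mul, smul_mul_assoc] using h1
        have h2 : c = ∑ i, bC.repr ⟨c, hc⟩ i • (bC i : A) := by
          have := congrArg (Stab F 1).subtype (bC.sum_repr ⟨c, hc⟩)
          simpa only [map_sum, map_smul, Submodule.subtype_apply] using this.symm
        rw [h2]
        simp only [Finset.mul_sum, mul_smul_comm, map_sum, map_smul, h3, smul_zero,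
          Finset.sum_const_zero]
      funext i
      exact Fintype.linearIndependent_iff.mp bC.linearIndependent v (by exact_mod_cast h0) i

theorem linSum_pow_dvd_charPoly (F : Module.Dual ℂ A) :
    linSum ^ Module.finrank ℂ (Stab F 1) ∣ charPoly F := by
  obtain ⟨E, d, m, h, -, -⟩ := exists_charPoly_factor F
  exact (Dvd.intro _ rfl).trans h.symm.dvd

/-- The substitution `λ = 1`, `μ = X - 1`. -/
def dehomogenize : MvPolynomial (Fin 2) ℂ →ₐ[ℂ] Polynomial ℂ :=
  MvPolynomial.aeval ![1, Polynomial.X - 1]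

@[simp]
theorem dehomogenize_linSum : dehomogenize linSum = Polynomial.X := by
  simp [dehomogenize]

theorem eval_dehomogenize (p : MvPolynomial (Fin 2) ℂ) (s : ℂ) :
    (dehomogenize p).eval s = MvPolynomial.eval ![1, s - 1] p := by
  have : (Polynomial.evalRingHom s).comp (dehomogenize : _ →+* Polynomial ℂ) =
      MvPolynomial.eval ![1, s - 1] := by
    apply MvPolynomial.ringHom_ext
    · intro r
      simp [dehomogenize]
    · intro i
      fin_cases i <;> simp [dehomogenize]
  exact RingHom.congr_fun this p

theorem eval_eq_of_linSum_dvd_sub {E : MvPolynomial (Fin 2) ℂ} {d : ℂ} {m : ℕ}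
    (h : linSum ∣ E - MvPolynomial.C d * MvPolynomial.X 0 ^ m) :
    MvPolynomial.eval ![1, -1] E = d := by
  obtain ⟨q, hq⟩ := h
  have := congrArg (MvPolynomial.eval ![1, -1]) hq
  simpa [sub_eq_zero] using this

/-- If the form degenerates, `λ + μ` also divides the cofactor, which gives one power too many. -/
theorem IsPrecise.nondegOnStab {F : Module.Dual ℂ A} (h : IsPrecise 1 F) : NondegOnStab F := by
  obtain ⟨E, d, m, h1, h2, h3⟩ := exists_charPoly_factor F
  rw [← h3]
  rintro rfl
  rw [map_zero, zero_mul, sub_zero] at h2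
  have h4 := (emultiplicity_eq_coe.mp h).2
  apply h4
  rw [pow_succ]
  exact (mul_dvd_mul_left _ h2).trans h1.symm.dvd

/-- Dehomogenizing turns `λ + μ` into `X`, so up to a unit this coefficient is the cofactor's value
at `(1, -1)`. -/
theorem NondegOnStab.coeff_ne_zero {F : Module.Dual ℂ A} (h : NondegOnStab F) :
    (dehomogenize (charPoly F)).coeff (Module.finrank ℂ (Stab F 1)) ≠ 0 := by
  obtain ⟨E, d, m, h1, h2, h3⟩ := exists_charPoly_factor F
  have hd := h3.mpr h
  obtain ⟨u, hu⟩ := h1.symm.map dehomogenize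
  have hu' := u.isUnit
  obtain ⟨r, hr, hru⟩ := Polynomial.isUnit_iff.mp hu'
  rw [← hu, map_mul, map_pow, dehomogenize_linSum, ← hru, Polynomial.coeff_mul_C,
    Polynomial.coeff_X_pow_mul', if_pos le_rfl, Nat.sub_self, Polynomial.coeff_zero_eq_eval_zero,
    eval_dehomogenize, zero_sub, eval_eq_of_linSum_dvd_sub h2]
  exact mul_ne_zero hd hr.ne_zero

/-- The coefficient bounds the exponent of `λ + μ` above by `k`, the stabilizer bounds it below by
its dimension, so all three agree. In use, `k` is the minimal stabilizer dimension. -/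
theorem isPrecise_of_coeff_ne_zero {F : Module.Dual ℂ A} {k : ℕ}
    (hk : k ≤ Module.finrank ℂ (Stab F 1)) (h : (dehomogenize (charPoly F)).coeff k ≠ 0) :
    IsPrecise 1 F := by
  have key : ∀ j, k < j → ¬ linSum ^ j ∣ charPoly F := by
    intro j hj hdvd
    have := map_dvd dehomogenize hdvd
    rw [map_pow, dehomogenize_linSum, Polynomial.X_pow_dvd_iff] at this
    exact h (this k hj)
  have hle : Module.finrank ℂ (Stab F 1) ≤ k := by
    by_contra hlt
    exact key _ (not_le.mp hlt) (linSum_pow_dvd_charPoly F)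
  exact emultiplicity_eq_coe.mpr ⟨linSum_pow_dvd_charPoly F, key _ (by omega)⟩

theorem IsPrecise.charPoly_ne_zero {F : Module.Dual ℂ A} (h : IsPrecise 1 F) :
    charPoly F ≠ 0 := by
  intro h0
  have h1 := (emultiplicity_eq_coe.mp h).2
  exact h1 (h0 ▸ dvd_zero _)

/-- Left null vectors of `A_F - α A_Fᵀ` are the coordinate vectors of elements of `Stab F α`. -/
theorem isCharRoot_coe_iff {F : Module.Dual ℂ A} {α : ℂ} :
    IsCharRoot F (α : OnePoint ℂ) ↔ Stab F α ≠ ⊥ := by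
  change MvPolynomial.eval ![1, -α] (charPoly F) = 0 ↔ _
  let e := Module.finBasis ℂ A
  rw [charPoly, charPolyIn, RingHom.map_det, ← Matrix.exists_vecMul_eq_zero_iff,
    Submodule.ne_bot_iff]
  have key : ∀ v : Fin _ → ℂ, Matrix.vecMul v ((MvPolynomial.eval ![1, -α]).mapMatrix
      ((MvPolynomial.X 0 : MvPolynomial (Fin 2) ℂ) • (formMatrix e F).map MvPolynomial.C +
        (MvPolynomial.X 1 : MvPolynomial (Fin 2) ℂ) •
          (formMatrix e F).transpose.map MvPolynomial.C)) = 0 ↔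
      ∑ i, v i • e i ∈ Stab F α := by
    intro v
    have h1 : ∀ j, F ((∑ i, v i • e i) * e j) - α * F (e j * ∑ i, v i • e i) =
        ∑ i, v i * (F (e i * e j) - α * F (e j * e i)) := by
      intro j
      simp only [Finset.sum_mul, Finset.mul_sum, smul_mul_assoc, mul_smul_comm, map_sum, map_smul,
        smul_eq_mul, ← Finset.sum_sub_distrib]
      refine Finset.sum_congr rfl fun i _ => by ring
    rw [funext_iff]
    constructor
    · intro h
      refine mem_Stab_of_basis e fun j => ?_
      rw [← sub_eq_zero, h1]
      simpa [Matrix.vecMul, dotProduct, formMatrix, sub_eq_add_neg] using h j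
    · intro h j
      have := h (e j)
      rw [h1] at this
      simpa [Matrix.vecMul, dotProduct, formMatrix, sub_eq_add_neg] using this
  constructor
  · rintro ⟨v, hv0, hv⟩
    refine ⟨_, (key v).mp hv, fun h0 => hv0 ?_⟩
    funext i
    exact Fintype.linearIndependent_iff.mp e.linearIndependent v h0 i
  · rintro ⟨a, ha, ha0⟩
    refine ⟨e.repr a, fun h0 => ha0 ?_, (key _).mpr ?_⟩
    · have : e.repr a = 0 := DFunLike.coe_injective h0
      rwa [LinearEquiv.map_eq_zero_iff] at this
    · rwa [e.sum_repr]

/-- The finite roots of the characteristic polynomial of a precise functional form a finite set. -/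
theorem IsPrecise.finite_roots {F : Module.Dual ℂ A} (h : IsPrecise 1 F) :
    {α : ℂ | Stab F α ≠ ⊥}.Finite := by
  have hp : dehomogenize (charPoly F) ≠ 0 := by
    intro h0
    have := h.nondegOnStab.coeff_ne_zero
    rw [h0] at this
    simp at this
  -- At `X = s` one has `μ = s - 1`, so `μ = -α` means `s = 1 - α`.
  refine ((Polynomial.finite_setOfPred_isRoot hp).image fun s => 1 - s).subset ?_
  intro α hα
  refine ⟨1 - α, ?_, by ring⟩
  have h1 : MvPolynomial.eval ![1, -α] (charPoly F) = 0 := isCharRoot_coe_iff.mpr hα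
  change (dehomogenize (charPoly F)).eval (1 - α) = 0
  rw [eval_dehomogenize, show (1 - α - 1 : ℂ) = -α by ring, h1]

end Precise

/-! ### Semicontinuity of stabilizers, and commutativity at regular functionals. -/

section Openness

/-- Injectivity of a linear map between finite-dimensional spaces is an open condition. -/
theorem eventually_injective {Z U V : Type*} [TopologicalSpace Z] [AddCommGroup U] [Module ℂ U]
    [AddCommGroup V] [Module ℂ V] [FiniteDimensional ℂ U] {f : Z → U →ₗ[ℂ] V} {z : Z}
    (hf : ∀ (u : U) (g : Module.Dual ℂ V), Continuous fun w => g (f w u))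
    (h : Function.Injective (f z)) : ∀ᶠ w in 𝓝 z, Function.Injective (f w) := by
  -- With a left inverse `L` of `f z`, the determinant of `L ∘ f w` is continuous in `w` and equals
  -- `1` at `z`.
  obtain ⟨L, hL⟩ := LinearMap.exists_leftInverse_of_injective _ (LinearMap.ker_eq_bot.mpr h)
  let e := Module.finBasis ℂ U
  have hc : Continuous fun w => (LinearMap.toMatrix e e (L ∘ₗ f w)).det := by
    refine Continuous.matrix_det (continuous_pi fun i => continuous_pi fun j => ?_)
    simpa [LinearMap.toMatrix_apply] using hf (e j) (e.coord i ∘ₗ L)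
  have hz : (LinearMap.toMatrix e e (L ∘ₗ f z)).det ≠ 0 := by
    simp [hL]
  filter_upwards [hc.continuousAt.eventually_ne hz] with w hw
  rw [LinearMap.det_toMatrix] at hw
  have hu := (LinearMap.isUnit_iff_isUnit_det _).mpr (isUnit_iff_ne_zero.mpr hw)
  have hb : Function.Injective (L ∘ₗ f w) := ((Module.End.isUnit_iff _).mp hu).injective
  exact Function.Injective.of_comp (f := L) hb

variable {A : Type*} [NonUnitalRing A] [Module ℂ A] [SMulCommClass ℂ A A] [IsScalarTower ℂ A A]

attribute [local instance] dualTopology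

theorem continuous_dual_apply (a : A) : Continuous fun F : Module.Dual ℂ A => F a :=
  (continuous_apply a).comp continuous_induced_dom

theorem continuous_dual_line (F G : Module.Dual ℂ A) : Continuous fun t : ℂ => F + t • G := by
  refine continuous_induced_rng.mpr (continuous_pi fun a => ?_)
  simp only [Function.comp_def, LinearMap.add_apply, LinearMap.smul_apply, smul_eq_mul]
  fun_prop

/-- The map `a ↦ (x ↦ F (a x) - α F (x a))`, with kernel `Stab_F(α)`. -/
def stabMap (α : ℂ) (F : Module.Dual ℂ A) : A →ₗ[ℂ] Module.Dual ℂ A :=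
  mulForm F - α • (mulForm F).flip

@[simp]
theorem stabMap_apply (α : ℂ) (F : Module.Dual ℂ A) (a x : A) :
    stabMap α F a x = F (a * x) - α * F (x * a) := rfl

theorem ker_stabMap (α : ℂ) (F : Module.Dual ℂ A) : LinearMap.ker (stabMap α F) = Stab F α := by
  ext a
  rw [LinearMap.mem_ker, LinearMap.ext_iff]
  rfl

variable [FiniteDimensional ℂ A]

theorem continuous_stabMap_apply (α : ℂ) (a : A) (g : Module.Dual ℂ (Module.Dual ℂ A)) :
    Continuous fun F : Module.Dual ℂ A => g (stabMap α F a) := by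
  obtain ⟨x, rfl⟩ := (Module.evalEquiv ℂ A).surjective g
  simp only [Module.evalEquiv_apply]
  exact (continuous_dual_apply _).sub (continuous_const.mul (continuous_dual_apply _))

/-- The dimension of the stabilizer is upper semicontinuous. -/
theorem eventually_finrank_Stab_le (α : ℂ) (F : Module.Dual ℂ A) :
    ∀ᶠ G in 𝓝 F, Module.finrank ℂ (Stab G α) ≤ Module.finrank ℂ (Stab F α) := by
  obtain ⟨W, hW⟩ := (Stab F α).exists_isCompl
  have hinj : Function.Injective (stabMap α F ∘ₗ W.subtype) := by
    rw [← LinearMap.ker_eq_bot, LinearMap.ker_comp, ker_stabMap,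
      ← Submodule.disjoint_iff_comap_eq_bot]
    exact hW.symm.disjoint
  filter_upwards [eventually_injective (f := fun G => stabMap α G ∘ₗ W.subtype)
    (fun u g => continuous_stabMap_apply α _ g) hinj] with G hG
  rw [← LinearMap.ker_eq_bot, LinearMap.ker_comp, ker_stabMap,
      ← Submodule.disjoint_iff_comap_eq_bot] at hG
  have h1 := Submodule.finrank_add_finrank_le_of_disjoint hG
  have h2 := Submodule.finrank_add_eq_of_isCompl hW
  omega

theorem isOpen_Stab_eq_bot (α : ℂ) : IsOpen {F : Module.Dual ℂ A | Stab F α = ⊥} := by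
  rw [isOpen_iff_mem_nhds]
  intro F hF
  filter_upwards [eventually_finrank_Stab_le α F] with G hG
  rw [Set.mem_ofPred_eq] at hF
  rw [hF, finrank_bot, Nat.le_zero, Submodule.finrank_eq_zero] at hG
  exact hG

theorem isOpen_setOf_isRegular (α : ℂ) : IsOpen {F : Module.Dual ℂ A | IsRegular α F} := by
  rw [isOpen_iff_mem_nhds]
  intro F hF
  filter_upwards [eventually_finrank_Stab_le α F] with G hG
  exact Filter.Eventually.of_forall fun H => hG.trans (hF.finrank_le A H)

/-- The stabilizer of a `1`-regular functional is commutative. -/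
theorem IsRegular.commute {F : Module.Dual ℂ A} (hF : IsRegular 1 F) {a b : A}
    (ha : a ∈ Stab F 1) (hb : b ∈ Stab F 1) : a * b = b * a := by
  rw [← sub_eq_zero, ← Module.forall_dual_apply_eq_zero_iff ℂ]
  intro K
  by_contra hK
  obtain ⟨W, hW⟩ := (Stab F 1).exists_isCompl
  -- If `K(ab - ba) ≠ 0`, the functional `K([a, ·])` lies outside the range of `stabMap 1 F`, as
  -- evaluation at `b` shows. Perturbing `F` along `K` then raises the rank by one, against
  -- regularity.
  let Ψ : ℂ → (W × ℂ) →ₗ[ℂ] Module.Dual ℂ A := fun t =>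
    (stabMap 1 (F + t • K) ∘ₗ W.subtype).coprod (LinearMap.toSpanSingleton ℂ _ (stabMap 1 K a))
  have h0 : Function.Injective (Ψ 0) := by
    rw [injective_iff_map_eq_zero]
    rintro ⟨w, s⟩ hws
    have hws' : stabMap 1 F w + s • stabMap 1 K a = 0 := by simpa [Ψ] using hws
    have h1 := LinearMap.congr_fun hws' b
    have h2 := mem_Stab_one.mp hb w
    have h3 : s * K (a * b - b * a) = 0 := by
      simpa [h2] using h1
    have hs : s = 0 := (mul_eq_zero.mp h3).resolve_right hK
    subst hs
    rw [zero_smul, add_zero, ← LinearMap.mem_ker, ker_stabMap] at hws'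
    have : (w : A) = 0 := Submodule.disjoint_def.mp hW.disjoint _ hws' w.2
    simpa using this
  have hev := eventually_injective (f := Ψ) (z := 0) (by
    rintro ⟨w, s⟩ g
    simp only [Ψ, LinearMap.coprod_apply, map_add]
    exact ((continuous_stabMap_apply 1 _ g).comp (continuous_dual_line F K)).add
      continuous_const) h0
  obtain ⟨t, ht, ht0⟩ := ((hev.filter_mono nhdsWithin_le_nhds).and
    (self_mem_nhdsWithin : {(0 : ℂ)}ᶜ ∈ 𝓝[≠] (0 : ℂ))).exists
  have ht0 : t ≠ 0 := ht0
  have haF : stabMap 1 F a = 0 := by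
    rwa [← LinearMap.mem_ker, ker_stabMap]
  -- Since `stabMap 1 F a = 0`, the extra vector is the image of `t⁻¹ • a` under the perturbed map.
  have hΨ : Ψ t = stabMap 1 (F + t • K) ∘ₗ
      (W.subtype.coprod (LinearMap.toSpanSingleton ℂ _ (t⁻¹ • a))) := by
    refine LinearMap.prod_ext ?_ ?_
    · ext w : 1
      simp [Ψ]
    · refine LinearMap.ext_ring ?_
      have hadd : stabMap 1 (F + t • K) a = stabMap 1 F a + t • stabMap 1 K a := by
        ext x
        simp
        ring
      simp [Ψ, hadd, haF, smul_smul, inv_mul_cancel₀ ht0]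
  have h4 : Module.finrank ℂ (W × ℂ) ≤
      Module.finrank ℂ (LinearMap.range (stabMap 1 (F + t • K))) := by
    have hle : ∀ x, Ψ t x ∈ LinearMap.range (stabMap 1 (F + t • K)) := by
      intro x
      rw [hΨ]
      exact ⟨_, rfl⟩
    refine LinearMap.finrank_le_finrank_of_injective (f := (Ψ t).codRestrict _ hle) ?_
    intro x y hxy
    exact ht (congrArg Subtype.val hxy)
  rw [Module.finrank_prod, Module.finrank_self] at h4
  have h5 := LinearMap.finrank_range_add_finrank_ker (stabMap 1 (F + t • K))
  rw [ker_stabMap] at h5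
  have h6 := hF.finrank_le A (F + t • K)
  have h7 := Submodule.finrank_add_eq_of_isCompl hW
  omega

end Openness

/-! ### Coefficients of `χ_F` as polynomial functions of `F`. -/

section GenericCoeff

variable (A : Type*) [NonUnitalRing A] [Module ℂ A] [SMulCommClass ℂ A A] [IsScalarTower ℂ A A]
  [FiniteDimensional ℂ A]

/-- The coefficients of the dehomogenized characteristic polynomial are polynomial functions of
the values of the functional on a basis. -/
theorem exists_coeff_eq_eval (k : ℕ) :
    ∃ c : MvPolynomial (Fin (Module.finrank ℂ A)) ℂ, ∀ F : Module.Dual ℂ A,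
      (dehomogenize (charPoly F)).coeff k =
        MvPolynomial.eval (fun l => F (Module.finBasis ℂ A l)) c := by
  let e := Module.finBasis ℂ A
  let q : Matrix _ _ (MvPolynomial (Fin (Module.finrank ℂ A)) ℂ) := Matrix.of fun i j =>
    ∑ l, MvPolynomial.C (e.repr (e i * e j) l) * MvPolynomial.X l
  let D : Polynomial (MvPolynomial (Fin (Module.finrank ℂ A)) ℂ) :=
    (Matrix.of fun i j => Polynomial.C (q i j) +
      (Polynomial.X - 1) * Polynomial.C (q j i)).det
  refine ⟨D.coeff k, fun F => ?_⟩
  rw [← Polynomial.coeff_map]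
  congr 1
  have hq : ∀ i j, MvPolynomial.eval (fun l => F (e l)) (q i j) = F (e i * e j) := by
    intro i j
    have h := congrArg F (e.sum_repr (e i * e j))
    simp only [map_sum, map_smul, smul_eq_mul] at h
    simpa [q] using h
  rw [charPoly, charPolyIn, AlgHom.map_det, ← Polynomial.coe_mapRingHom, RingHom.map_det]
  congr 1
  ext i j : 2
  simp [formMatrix, dehomogenize, hq, e]

attribute [local instance] dualTopology

theorem isOpen_coeff_ne_zero (k : ℕ) :
    IsOpen {F : Module.Dual ℂ A | (dehomogenize (charPoly F)).coeff k ≠ 0} := by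
  obtain ⟨c, hc⟩ := exists_coeff_eq_eval A k
  simp only [hc]
  exact isOpen_ne_fun ((MvPolynomial.continuous_eval c).comp
    (continuous_pi fun l => continuous_dual_apply _)) continuous_const

/-- On the complex line from `F` to `G` the coefficient is a polynomial in the parameter, nonzero at
`t = 1`, so its finitely many zeros leave points arbitrarily close to `F`. -/
theorem dense_coeff_ne_zero {k : ℕ} {G : Module.Dual ℂ A}
    (hG : (dehomogenize (charPoly G)).coeff k ≠ 0) :
    Dense {F : Module.Dual ℂ A | (dehomogenize (charPoly F)).coeff k ≠ 0} := by
  obtain ⟨c, hc⟩ := exists_coeff_eq_eval A k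
  intro F
  let e := Module.finBasis ℂ A
  let p : Polynomial ℂ := MvPolynomial.aeval
    (fun l => Polynomial.C (F (e l)) + Polynomial.X * Polynomial.C ((G - F) (e l))) c
  have hp : ∀ t, p.eval t = (dehomogenize (charPoly (F + t • (G - F)))).coeff k := by
    intro t
    rw [hc, ← Polynomial.coe_evalRingHom]
    simp only [p, MvPolynomial.aeval_def, MvPolynomial.hom_eval₂]
    rw [MvPolynomial.eval, MvPolynomial.coe_eval₂Hom]
    congr 1
    · ext <;> simp
    · funext l
      simp [e]
  have hp0 : p ≠ 0 := by
    intro h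
    apply hG
    have := hp 1
    rw [h] at this
    simpa using this.symm
  have hev : ∀ᶠ t in 𝓝[≠] (0 : ℂ), p.eval t ≠ 0 := by
    have h := (Polynomial.finite_setOfPred_isRoot hp0).subset
      (Set.sdiff_subset (t := {0}))
    filter_upwards [mem_nhdsWithin_of_mem_nhds
      (h.isClosed.isOpen_compl.mem_nhds (x := (0 : ℂ)) (by simp)), self_mem_nhdsWithin]
      with t ht ht0 hpt
    exact ht ⟨hpt, ht0⟩
  have hcont := (continuous_dual_line F (G - F)).tendsto 0
  rw [zero_smul, add_zero] at hcont
  refine mem_closure_of_tendsto (b := 𝓝[≠] (0 : ℂ)) (hcont.mono_left nhdsWithin_le_nhds) ?_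
  filter_upwards [hev] with t ht
  rwa [hp] at ht

end GenericCoeff

/-! ### A slice for conjugation, and a criterion for regularity. -/

/-- The map `(m, c) ↦ (h + P c) * (1 + l m) * (1 + r m)⁻¹` is open at the origin when its
derivative is onto; here a normed algebra `R` acts on `D` on the right by `β`. -/
theorem map_nhds_conj_eq {V D R : Type*} [NormedAddCommGroup V] [NormedSpace ℂ V]
    [CompleteSpace V] [NormedAddCommGroup D] [NormedSpace ℂ D] [CompleteSpace D] [NormedRing R]
    [NormedAlgebra ℂ R] [CompleteSpace R] (β : D →L[ℂ] R →L[ℂ] D) (l r : V →L[ℂ] R) (h : D)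
    (P : D →L[ℂ] D) (hone : ∀ c, β c 1 = c)
    (hsurj : ∀ φ : D, ∃ (m : V) (c : D), P c + β h (l m - r m) = φ) :
    Filter.map (fun p : V × D => β (h + P p.2) ((1 + l p.1) * Ring.inverse (1 + r p.1))) (𝓝 0) =
      𝓝 h := by
  have d1 : HasStrictFDerivAt (fun p : V × D => β (h + P p.2))
      (β ∘L P ∘L ContinuousLinearMap.snd ℂ V D) 0 := by
    simp only [map_add]
    exact (β ∘L P ∘L ContinuousLinearMap.snd ℂ V D).hasStrictFDerivAt.const_add (β h)
  have d2 : HasStrictFDerivAt (fun p : V × D => 1 + l p.1)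
      (l ∘L ContinuousLinearMap.fst ℂ V D) 0 :=
    (l ∘L ContinuousLinearMap.fst ℂ V D).hasStrictFDerivAt.const_add 1
  have d3 : HasStrictFDerivAt (fun p : V × D => 1 + r p.1)
      (r ∘L ContinuousLinearMap.fst ℂ V D) 0 :=
    (r ∘L ContinuousLinearMap.fst ℂ V D).hasStrictFDerivAt.const_add 1
  have h0 : HasStrictFDerivAt (Ring.inverse : R → R)
      (-(ContinuousLinearMap.mulLeftRight ℂ R) ↑(1 : Rˣ)⁻¹ ↑(1 : Rˣ)⁻¹)
      (1 + r (0 : V × D).1) := by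
    have := hasStrictFDerivAt_ringInverse (𝕜 := ℂ) (1 : Rˣ)
    simpa using this
  have d4 := h0.comp (0 : V × D) d3
  have d5 := d1.clm_apply (d2.mul' d4)
  -- The strict derivative at the origin is `(m, c) ↦ P c + β h (l m - r m)`, onto by hypothesis.
  have hmap := d5.map_nhds_eq_of_surj (by
    rw [LinearMap.range_eq_top]
    intro φ
    obtain ⟨m, c, hmc⟩ := hsurj φ
    refine ⟨(m, c), ?_⟩
    rw [← hmc]
    simp [hone]
    abel)
  simpa [Function.comp_def, hone] using hmap

section Slice

variable {A : Type*} [NonUnitalRing A] [Module ℂ A] [SMulCommClass ℂ A A] [IsScalarTower ℂ A A]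
  [FiniteDimensional ℂ A]

/-- A pair of dual bases of the stabilizer, on which the form is nondegenerate. -/
theorem NondegOnStab.exists_dual_bases {F : Module.Dual ℂ A} (h : NondegOnStab F) :
    ∃ u v : Fin (Module.finrank ℂ (Stab F 1)) → A, (∀ i, u i ∈ Stab F 1) ∧
      (∀ i, v i ∈ Stab F 1) ∧ ∀ c ∈ Stab F 1, ∑ i, F (c * v i) • u i = c := by
  let B : LinearMap.BilinForm ℂ (Stab F 1) := (mulForm F).restrict (Stab F 1)
  have hB : B.Nondegenerate := by
    refine ⟨fun c hc => ?_, fun c hc => ?_⟩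
    · exact Subtype.ext (h c c.2 fun c' hc' => hc ⟨c', hc'⟩)
    · refine Subtype.ext (h c c.2 fun c' hc' => ?_)
      rw [mem_Stab_one.mp c.2]
      exact hc ⟨c', hc'⟩
  let b := Module.finBasis ℂ (Stab F 1)
  let b' := B.dualBasis hB b
  have hd : ∀ i j, F (b i * b' j) = if i = j then 1 else 0 := by
    intro i j
    rw [mem_Stab_one.mp (b i).2]
    exact LinearMap.BilinForm.apply_dualBasis_left hB b j i
  refine ⟨fun i => b i, fun i => b' i, fun i => (b i).2, fun i => (b' i).2, fun c hc => ?_⟩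
  have h2 : c = ∑ i, b.repr ⟨c, hc⟩ i • (b i : A) := by
    have := congrArg (Stab F 1).subtype (b.sum_repr ⟨c, hc⟩)
    simpa only [map_sum, map_smul, Submodule.subtype_apply] using this.symm
  have h3 : ∀ j, F (c * b' j) = b.repr ⟨c, hc⟩ j := by
    intro j
    have := congrArg (fun x => F (x * b' j)) h2
    simpa [Finset.sum_mul, smul_mul_assoc, hd, -Module.Basis.sum_repr] using this
  simp only [h3]
  exact h2.symm

/-- Conjugation by `1 + a` does not decrease the stabilizer. -/
theorem finrank_le_finrank_Stab_conj {H H' : Module.Dual ℂ A} {a : A} {C : Submodule ℂ A}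
    (hC : C ≤ Stab H 1) (hl : Function.Injective fun y : A => y + a * y)
    (hr : Function.Injective fun y : A => y + y * a)
    (hH : ∀ y, H' (y + y * a) = H (y + a * y)) :
    Module.finrank ℂ C ≤ Module.finrank ℂ (Stab H' 1) := by
  let L := LinearEquiv.ofInjectiveEndo (LinearMap.id + LinearMap.mul ℂ A a) hl
  let R := LinearEquiv.ofInjectiveEndo (LinearMap.id + (LinearMap.mul ℂ A).flip a) hr
  have hL : ∀ y, L y = y + a * y := fun _ => rfl
  have hR : ∀ y, R y = y + y * a := fun _ => rfl
  -- `L` and `R` both turn the twisted product `yz + yaz` into the product of `A`. Hence `R ∘ L⁻¹`,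
  -- which is conjugation by `1 + a` in the unitization, carries `Stab H 1` into `Stab H' 1`.
  have hmul : ∀ y z, H' (R y * R z) = H (L y * L z) := by
    intro y z
    have h1 : R y * R z = R (y * z + y * a * z) := by
      simp only [hR]
      noncomm_ring
    have h2 : L y * L z = L (y * z + y * a * z) := by
      simp only [hL]
      noncomm_ring
    rw [h1, h2, hR, hL, hH]
  calc Module.finrank ℂ C
      = Module.finrank ℂ (C.map (L.symm.trans R : A →ₗ[ℂ] A)) :=
        (LinearEquiv.finrank_map_eq (L.symm.trans R) C).symm
    _ ≤ _ := by
      refine Submodule.finrank_mono ?_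
      rintro _ ⟨c, hc, rfl⟩
      rw [mem_Stab_one]
      intro x
      obtain ⟨z, rfl⟩ := R.surjective x
      obtain ⟨y, rfl⟩ := L.surjective c
      have : (L.symm.trans R : A →ₗ[ℂ] A) (L y) = R y := by simp
      rw [this, hmul, hmul]
      exact mem_Stab_one.mp (hC hc) _

attribute [local instance] dualTopology

/-- A functional whose form is nondegenerate on a commutative stabilizer is `1`-regular. -/
theorem NondegOnStab.isRegular {F : Module.Dual ℂ A} (h : NondegOnStab F)
    (hcomm : ∀ a ∈ Stab F 1, ∀ b ∈ Stab F 1, a * b = b * a) : IsRegular 1 F := by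
  obtain ⟨u, v, hu, hv, huv⟩ := h.exists_dual_bases
  let b := Module.finBasis ℂ A
  let V := Fin (Module.finrank ℂ A) → ℂ
  let e : A ≃ₗ[ℂ] V := b.equivFun
  let mulV : V →ₗ[ℂ] V →ₗ[ℂ] V :=
    ((LinearMap.mul ℂ A).compl₁₂ (e.symm : V →ₗ[ℂ] A) (e.symm : V →ₗ[ℂ] A)).compr₂
      (e : A →ₗ[ℂ] V)
  let toL : (V →ₗ[ℂ] V →ₗ[ℂ] V) → (V →L[ℂ] V →L[ℂ] V) := fun f =>
    LinearMap.toContinuousLinearMap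
      ((LinearMap.toContinuousLinearMap : (V →ₗ[ℂ] V) ≃ₗ[ℂ] (V →L[ℂ] V)).toLinearMap ∘ₗ f)
  let l := toL mulV
  let r := toL mulV.flip
  have hl : ∀ m x, l m x = e (e.symm m * e.symm x) := fun _ _ => rfl
  have hr : ∀ m x, r m x = e (e.symm x * e.symm m) := fun _ _ => rfl
  -- `π` is the projection onto the stabilizer along its orthogonal complement for `F(xy)`.
  let π : A →ₗ[ℂ] A := ∑ i, ((mulForm F).flip (v i)).smulRight (u i)
  have hπ : ∀ x, π x = ∑ i, F (x * v i) • u i := by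
    intro x
    simp [π]
  have hπC : ∀ c ∈ Stab F 1, π c = c := fun c hc => (hπ c).trans (huv c hc)
  -- Commutativity enters here: it makes every `F + φ ∘ π` keep all of `Stab F 1` in its stabilizer.
  have hπ0 : ∀ c ∈ Stab F 1, ∀ x, π (c * x) = π (x * c) := by
    intro c hc x
    rw [hπ, hπ]
    refine Finset.sum_congr rfl fun i _ => ?_
    rw [mul_assoc, mem_Stab_one.mp hc, mul_assoc, mul_assoc, hcomm _ (hv i) _ hc]
  let toD : Module.Dual ℂ A → (V →L[ℂ] ℂ) := fun H =>
    LinearMap.toContinuousLinearMap (H ∘ₗ (e.symm : V →ₗ[ℂ] A))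
  let ofD : (V →L[ℂ] ℂ) → Module.Dual ℂ A := fun f => (f : V →ₗ[ℂ] ℂ) ∘ₗ (e : A →ₗ[ℂ] V)
  have hof : ∀ H, ofD (toD H) = H := by
    intro H
    ext x
    simp [ofD, toD]
  have htoD : Continuous toD := by
    have : toD = fun H => ∑ i, H (b i) • (ContinuousLinearMap.proj i : V →L[ℂ] ℂ) := by
      funext H
      refine ContinuousLinearMap.ext fun x => ?_
      change H (b.equivFun.symm x) = _
      rw [Module.Basis.equivFun_symm_apply, map_sum, sum_apply]
      refine Finset.sum_congr rfl fun i _ => ?_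
      change H (x i • b i) = H (b i) * x i
      rw [map_smul, smul_eq_mul, mul_comm]
    rw [this]
    exact continuous_finsetSum _ fun i _ => (continuous_dual_apply _).smul continuous_const
  let πV : V →L[ℂ] V := LinearMap.toContinuousLinearMap
    ((e : A →ₗ[ℂ] V) ∘ₗ π ∘ₗ (e.symm : V →ₗ[ℂ] A))
  have hπV : ∀ x, πV x = e (π (e.symm x)) := fun _ => rfl
  -- Every functional near `F` is a conjugate of some `F + φ ∘ π`, so its stabilizer is at least as
  -- large as that of `F`. For surjectivity, `φ - φ ∘ π` kills the stabilizer and is therefore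
  -- `F([m, ·])` for some `m`.
  have hmap := map_nhds_conj_eq (ContinuousLinearMap.compL ℂ V V ℂ) l r (toD F)
    ((ContinuousLinearMap.compL ℂ V V ℂ).flip πV) (fun c => ContinuousLinearMap.ext fun _ => rfl) (by
    intro φ
    have hker : ∀ ψ : Module.Dual ℂ A, (∀ c ∈ Stab F 1, ψ c = 0) →
        ∃ m, ∀ x, F (m * x) - F (x * m) = ψ x := by
      intro ψ hψ
      have hrange : LinearMap.range (stabMap 1 F) = (Stab F 1).dualAnnihilator := by
        refine Submodule.eq_of_le_of_finrank_eq ?_ ?_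
        · rintro _ ⟨m, rfl⟩
          rw [Submodule.mem_dualAnnihilator]
          intro c hc
          simp [mem_Stab_one.mp hc]
        · have h1 := LinearMap.finrank_range_add_finrank_ker (stabMap 1 F)
          have h2 := Subspace.finrank_add_finrank_dualAnnihilator_eq (Stab F 1)
          rw [ker_stabMap] at h1
          omega
      have : ψ ∈ LinearMap.range (stabMap 1 F) := by
        rw [hrange, Submodule.mem_dualAnnihilator]
        exact hψ
      obtain ⟨m, hm⟩ := this
      refine ⟨m, fun x => ?_⟩
      rw [← hm]
      simp
    obtain ⟨m, hm⟩ := hker (ofD φ - ofD φ ∘ₗ π) (by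
      intro c hc
      simp [hπC c hc])
    refine ⟨e m, φ, ContinuousLinearMap.ext fun x => ?_⟩
    have h1 := hm (e.symm x)
    have h2 : ofD φ (e.symm x) = φ x := congrArg φ (e.apply_symm_apply x)
    rw [LinearMap.sub_apply, h2] at h1
    change φ (πV x) + F (e.symm (l (e m) x - r (e m) x)) = φ x
    rw [hl, hr, hπV, map_sub, e.symm_apply_apply, e.symm_apply_apply, e.symm_apply_apply, map_sub,
      h1]
    change φ (e (π (e.symm x))) + (φ x - φ (e (π (e.symm x)))) = φ x
    ring)
  have hunit : ∀ f : V →L[ℂ] V →L[ℂ] V, ∀ᶠ p in 𝓝 (0 : V × (V →L[ℂ] ℂ)),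
      IsUnit (1 + f p.1 : V →L[ℂ] V) := by
    intro f
    have hc : Continuous fun p : V × (V →L[ℂ] ℂ) => (1 + f p.1 : V →L[ℂ] V) := by fun_prop
    exact hc.continuousAt.eventually (Units.isOpen.mem_nhds (by simp))
  have hev : ∀ᶠ f in 𝓝 (toD F), Module.finrank ℂ (Stab F 1) ≤
      Module.finrank ℂ (Stab (ofD f) 1) := by
    rw [← hmap, Filter.eventually_map]
    filter_upwards [hunit l, hunit r] with p hpl hpr
    have hinj : ∀ T : V →L[ℂ] V, IsUnit T → Function.Injective T := by
      intro T hT x y hxy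
      have h1 : ∀ z, (Ring.inverse T) (T z) = z := fun z => by
        rw [← mul_apply_eq_comp, Ring.inverse_mul_cancel _ hT,
          one_apply_eq_self]
      rw [← h1 x, hxy, h1]
    refine finrank_le_finrank_Stab_conj (H := ofD (toD F + p.2 ∘L πV)) (a := e.symm p.1)
      ?_ ?_ ?_ ?_
    · intro c hc
      rw [mem_Stab_one]
      intro x
      simp [ofD, toD, hπV, hπ0 c hc, mem_Stab_one.mp hc]
    · intro x y hxy
      apply e.injective
      apply hinj _ hpl
      simpa [hl] using congrArg e hxy
    · intro x y hxy
      apply e.injective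
      apply hinj _ hpr
      simpa [hr] using congrArg e hxy
    · intro y
      have h1 : e (y + y * e.symm p.1) = (1 + r p.1 : V →L[ℂ] V) (e y) := by
        simp [hr]
      have h2 : e (y + e.symm p.1 * y) = (1 + l p.1 : V →L[ℂ] V) (e y) := by
        simp [hl]
      have h3 : Ring.inverse (1 + r p.1 : V →L[ℂ] V) ((1 + r p.1 : V →L[ℂ] V) (e y)) = e y := by
        rw [← mul_apply_eq_comp, Ring.inverse_mul_cancel _ hpr,
          one_apply_eq_self]
      change (toD F + p.2 ∘L πV) ((1 + l p.1 : V →L[ℂ] V)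
        (Ring.inverse (1 + r p.1 : V →L[ℂ] V) (e (y + y * e.symm p.1)))) =
          (toD F + p.2 ∘L πV) (e (y + e.symm p.1 * y))
      rw [h1, h2, h3]
  have := (htoD.tendsto F).eventually hev
  refine this.mono fun G hG => ?_
  rwa [hof] at hG

end Slice

/-! ### A pencil equation on a tensor product. -/

section LinearAlgebra

/-- A factorization, unlike a bare inclusion of kernels, passes directly to tensor products. -/
theorem exists_comp_eq_of_ker_le {U V W : Type*} [AddCommGroup U] [Module ℂ U] [AddCommGroup V]
    [Module ℂ V] [AddCommGroup W] [Module ℂ W] {f : U →ₗ[ℂ] V} {g : U →ₗ[ℂ] W}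
    (h : LinearMap.ker f ≤ LinearMap.ker g) : ∃ u : V →ₗ[ℂ] W, g = u ∘ₗ f := by
  obtain ⟨s, hs⟩ := LinearMap.exists_rightInverse_of_surjective f.rangeRestrict
    (LinearMap.range_rangeRestrict f)
  obtain ⟨u, hu⟩ := LinearMap.exists_extend (g ∘ₗ s)
  refine ⟨u, LinearMap.ext fun x => ?_⟩
  have h1 : u (f x) = g (s (f.rangeRestrict x)) := LinearMap.congr_fun hu (f.rangeRestrict x)
  have h2 : f (s (f.rangeRestrict x)) = f x :=
    congrArg Subtype.val (LinearMap.congr_fun hs (f.rangeRestrict x))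
  have h3 : x - s (f.rangeRestrict x) ∈ LinearMap.ker g := h (by simp [h2])
  rw [LinearMap.comp_apply, h1, ← sub_eq_zero, ← map_sub]
  exact h3

/-- If `S` and the pencil `α P - Q` have no common eigenvalue besides `1`, and `S` is semisimple at
`1`, then solutions of `(S ⊗ P) z = (1 ⊗ Q) z` are fixed by `S ⊗ 1`. -/
theorem rTensor_eq_self_of_pencil {V W W' : Type*} [AddCommGroup V] [Module ℂ V]
    [FiniteDimensional ℂ V] [AddCommGroup W] [Module ℂ W] [FiniteDimensional ℂ W]
    [AddCommGroup W'] [Module ℂ W'] (S : V →ₗ[ℂ] V) (P Q : W →ₗ[ℂ] W')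
    (hS : ∀ v, (S - 1) ((S - 1) v) = 0 → (S - 1) v = 0)
    (hsp : ∀ α : ℂ, α ≠ 1 → Function.Injective (S - α • (1 : Module.End ℂ V)) ∨
      Function.Injective (α • P - Q))
    {z : V ⊗[ℂ] W} (hz : TensorProduct.map S P z = Q.lTensor V z) : S.rTensor W z = z := by
  let T : Module.End ℂ (V ⊗[ℂ] W) := S.rTensor W
  let K : Submodule ℂ (V ⊗[ℂ] W) := LinearMap.ker (TensorProduct.map S P - Q.lTensor V)
  have hK : ∀ {x}, x ∈ K ↔ TensorProduct.map S P x = Q.lTensor V x := by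
    intro x
    rw [LinearMap.mem_ker, LinearMap.sub_apply, sub_eq_zero]
  have hPT : ∀ x, TensorProduct.map S P x = P.lTensor V (T x) := by
    intro x
    rw [← LinearMap.lTensor_comp_rTensor, LinearMap.comp_apply]
  have hTK : ∀ x ∈ K, T x ∈ K := by
    intro x hx
    rw [hK] at hx ⊢
    have h1 : ∀ (R : W →ₗ[ℂ] W') y, R.lTensor V (T y) = S.rTensor W' (R.lTensor V y) := by
      intro R y
      rw [← LinearMap.comp_apply, ← LinearMap.comp_apply, LinearMap.lTensor_comp_rTensor,
        LinearMap.rTensor_comp_lTensor]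
    rw [hPT, h1, ← hPT, hx, h1]
  -- The solution space `K` is `T`-stable. If `Y` were nonzero, `T` would have an eigenvector in it:
  -- eigenvalue `1` contradicts semisimplicity, any other contradicts `hsp`.
  let Y : Submodule ℂ (V ⊗[ℂ] W) := K.map (T - 1)
  have hTY : ∀ y ∈ Y, T y ∈ Y := by
    rintro _ ⟨x, hx, rfl⟩
    exact ⟨T x, hTK x hx, by simp⟩
  have hYK : Y ≤ K := by
    rintro _ ⟨x, hx, rfl⟩
    exact K.sub_mem (hTK x hx) hx
  have hsub : ∀ α : ℂ, T - α • 1 = (S - α • (1 : Module.End ℂ V)).rTensor W := by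
    intro α
    rw [LinearMap.rTensor_sub, LinearMap.rTensor_smul]
    congr 2
    exact (LinearMap.rTensor_id W V).symm
  have hY : Y = ⊥ := by
    by_contra hne
    have : Nontrivial Y := Submodule.nontrivial_iff_ne_bot.mpr hne
    obtain ⟨α, hα⟩ := Module.End.exists_eigenvalue (T.restrict hTY)
    obtain ⟨⟨y, hy⟩, hyα⟩ := hα.exists_hasEigenvector
    have hTy : T y = α • y := congrArg Subtype.val hyα.apply_eq_smul
    apply hyα.2
    refine Subtype.ext ?_
    change y = 0
    by_cases h1 : α = 1
    · subst h1
      obtain ⟨x, hx, rfl⟩ := hy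
      have hker : LinearMap.ker ((S - 1) ∘ₗ (S - 1)) ≤ LinearMap.ker (S - 1) := fun v hv => hS v hv
      obtain ⟨g, hg⟩ := exists_comp_eq_of_ker_le hker
      have h2 : T - 1 = (S - 1).rTensor W := by simpa using hsub 1
      have h3 : (T - 1) ((T - 1) x) = 0 := by
        rw [LinearMap.sub_apply, hTy]
        simp
      have h4 : (T - 1) x = g.rTensor W ((T - 1) ((T - 1) x)) := by
        rw [h2]
        conv_lhs => rw [hg]
        rw [LinearMap.rTensor_comp, LinearMap.rTensor_comp]
        rfl
      rw [h4, h3, map_zero]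
    · rcases hsp α h1 with h2 | h2
      · have h3 := Module.Flat.rTensor_preserves_injective_linearMap (M := W) _ h2
        rw [← hsub] at h3
        apply h3
        simp [hTy]
      · have h3 := Module.Flat.lTensor_preserves_injective_linearMap (M := V) _ h2
        apply h3
        rw [map_zero, LinearMap.lTensor_sub, LinearMap.lTensor_smul, LinearMap.sub_apply,
          LinearMap.smul_apply, ← hK.mp (hYK hy), hPT, hTy, map_smul, sub_self]
  have h5 : (T - 1) z ∈ Y := ⟨z, hK.mpr hz, rfl⟩
  rw [hY, Submodule.mem_bot] at h5
  exact sub_eq_zero.mp h5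

end LinearAlgebra

/-! ### The stabilizer of `F ⊗ G`. -/

section Tensor

variable {A B : Type*}
  [NonUnitalRing A] [Module ℂ A] [SMulCommClass ℂ A A] [IsScalarTower ℂ A A]
  [NonUnitalRing B] [Module ℂ B] [SMulCommClass ℂ B B] [IsScalarTower ℂ B B]

/-- The functional `F ⊗ G` on `A ⊗ B`. -/
def tensorDual (F : Module.Dual ℂ A) (G : Module.Dual ℂ B) : Module.Dual ℂ (A ⊗[ℂ] B) :=
  TensorProduct.dualDistrib ℂ A B (F ⊗ₜ G)

@[simp]
theorem tensorDual_tmul (F : Module.Dual ℂ A) (G : Module.Dual ℂ B) (a : A) (b : B) :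
    tensorDual F G (a ⊗ₜ b) = F a * G b := rfl

theorem tmul_mem_Stab_tensorDual {F : Module.Dual ℂ A} {G : Module.Dual ℂ B} {a : A} {b : B}
    (ha : a ∈ Stab F 1) (hb : b ∈ Stab G 1) : a ⊗ₜ[ℂ] b ∈ Stab (tensorDual F G) 1 := by
  rw [mem_Stab_one] at *
  intro w
  induction w with
  | zero => simp
  | add x y hx hy => rw [mul_add, add_mul, map_add, map_add, hx, hy]
  | tmul x y => simp [ha, hb]

variable [FiniteDimensional ℂ A] [FiniteDimensional ℂ B]

theorem map_mulForm_of_mem_Stab {F : Module.Dual ℂ A} {G : Module.Dual ℂ B} {z : A ⊗[ℂ] B}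
    (hz : z ∈ Stab (tensorDual F G) 1) :
    TensorProduct.map (mulForm F) (mulForm G) z =
      TensorProduct.map (mulForm F).flip (mulForm G).flip z := by
  apply (TensorProduct.dualDistribEquiv ℂ A B).injective
  change TensorProduct.dualDistrib ℂ A B _ = TensorProduct.dualDistrib ℂ A B _
  refine TensorProduct.ext' fun x y => ?_
  have h1 : ∀ z : A ⊗[ℂ] B, TensorProduct.dualDistrib ℂ A B
      (TensorProduct.map (mulForm F) (mulForm G) z) (x ⊗ₜ y) = tensorDual F G (z * x ⊗ₜ y) := by
    intro z
    induction z with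
    | zero => simp
    | add x y hx hy => rw [add_mul, map_add, map_add, map_add, LinearMap.add_apply, hx, hy]
    | tmul a b => simp
  have h2 : ∀ z : A ⊗[ℂ] B, TensorProduct.dualDistrib ℂ A B
      (TensorProduct.map (mulForm F).flip (mulForm G).flip z) (x ⊗ₜ y) =
        tensorDual F G (x ⊗ₜ y * z) := by
    intro z
    induction z with
    | zero => simp
    | add x y hx hy => rw [mul_add, map_add, map_add, map_add, LinearMap.add_apply, hx, hy]
    | tmul a b => simp
  rw [h1, h2]
  exact mem_Stab_one.mp hz _

/-- Under a disjointness condition on the roots, the stabilizer of `F ⊗ G` is spanned by the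
products of the elements of the two stabilizers. -/
theorem eq_sum_of_mem_Stab_tensorDual {F : Module.Dual ℂ A} {G : Module.Dual ℂ B}
    (hF : NondegOnStab F) (hF0 : Stab F 0 = ⊥)
    (hFG : ∀ α : ℂ, α ≠ 1 → Stab F α = ⊥ ∨ Stab G α⁻¹ = ⊥)
    {ι κ : Type*} [Fintype ι] [Fintype κ] {u v : ι → A} {u' v' : κ → B}
    (huv : ∀ c ∈ Stab F 1, ∑ i, F (c * v i) • u i = c)
    (huv' : ∀ c ∈ Stab G 1, ∑ j, G (c * v' j) • u' j = c)
    {z : A ⊗[ℂ] B} (hz : z ∈ Stab (tensorDual F G) 1) :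
    z = ∑ i, ∑ j, tensorDual F G (z * v i ⊗ₜ v' j) • u i ⊗ₜ[ℂ] u' j := by
  have hL : Function.Injective (mulForm F) := by
    rw [injective_iff_map_eq_zero]
    intro a ha
    have : a ∈ Stab F 0 := mem_Stab.mpr fun x => by
      simpa using LinearMap.congr_fun ha x
    rwa [hF0, Submodule.mem_bot] at this
  have hLs : Function.Surjective (mulForm F) :=
    (LinearMap.injective_iff_surjective_of_finrank_eq_finrank
      Subspace.dual_finrank_eq.symm).mp hL
  have hR : Function.Injective (mulForm F).flip := by
    rw [injective_iff_map_eq_zero]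
    intro a ha
    rw [← Module.forall_dual_apply_eq_zero_iff ℂ]
    intro φ
    obtain ⟨x, rfl⟩ := hLs φ
    exact LinearMap.congr_fun ha x
  let R : A ≃ₗ[ℂ] Module.Dual ℂ A := LinearEquiv.ofBijective (mulForm F).flip
    ⟨hR, (LinearMap.injective_iff_surjective_of_finrank_eq_finrank
      Subspace.dual_finrank_eq.symm).mp hR⟩
  have hRx : ∀ a x, R a x = F (x * a) := fun _ _ => rfl
  -- `S` is defined by `F(ax) = F(x·Sa)`; it exists because `0` is not a root.
  let S : A →ₗ[ℂ] A := R.symm.toLinearMap ∘ₗ mulForm F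
  have hRS : ∀ a, R (S a) = mulForm F a := fun a => R.apply_symm_apply _
  have hSα : ∀ α a, S a = α • a ↔ a ∈ Stab F α := by
    intro α a
    rw [← R.injective.eq_iff, hRS, mem_Stab, LinearMap.ext_iff]
    simp [hRx]
  have hS1 : ∀ a, (S - 1) a = 0 ↔ a ∈ Stab F 1 := by
    intro a
    rw [← hSα, one_smul, LinearMap.sub_apply, sub_eq_zero]
    rfl
  have hSG : TensorProduct.map S (mulForm G) z = (mulForm G).flip.lTensor A z := by
    have h1 := congrArg (TensorProduct.map R.symm.toLinearMap LinearMap.id)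
      (map_mulForm_of_mem_Stab hz)
    rw [← LinearMap.comp_apply, ← LinearMap.comp_apply, ← TensorProduct.map_comp,
      ← TensorProduct.map_comp] at h1
    have h2 : R.symm.toLinearMap ∘ₗ (mulForm F).flip = LinearMap.id :=
      LinearMap.ext fun x => R.symm_apply_apply x
    rw [h2] at h1
    exact h1
  have hSz : S.rTensor B z = z := by
    refine rTensor_eq_self_of_pencil S (mulForm G) (mulForm G).flip ?_ ?_ ?_
    -- Semisimplicity at `1`: `(S - 1)v` lies in the stabilizer and pairs with each `c` there to
    -- `F(vc) - F(cv) = 0`.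
    · intro v hv
      refine hF _ ((hS1 _).mp hv) fun c hc => ?_
      rw [mem_Stab_one.mp ((hS1 _).mp hv), ← hRx, LinearMap.sub_apply, map_sub, hRS]
      simp [hRx, mem_Stab_one.mp hc]
    · intro α hα
      by_cases hF' : Stab F α = ⊥
      · left
        rw [injective_iff_map_eq_zero]
        intro a ha
        have : a ∈ Stab F α := (hSα α a).mp (sub_eq_zero.mp ha)
        rwa [hF', Submodule.mem_bot] at this
      · right
        have hα0 : α ≠ 0 := by
          rintro rfl
          exact hF' hF0
        rw [injective_iff_map_eq_zero]
        intro b hb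
        have : b ∈ Stab G α⁻¹ := mem_Stab.mpr fun x => by
          have h1 := LinearMap.congr_fun hb x
          have h2 : α * G (b * x) - G (x * b) = 0 := by simpa using h1
          rw [← sub_eq_zero.mp h2, inv_mul_cancel_left₀ hα0]
        rwa [(hFG α hα).resolve_left hF', Submodule.mem_bot] at this
    · exact hSG
  -- Once `S ⊗ 1` fixes `z`, the pencil equation loses `S` and says that `z` is in the kernel of `1
  -- ⊗ stabMap 1 G`.
  have hGz : (stabMap 1 G).lTensor A z = 0 := by
    have h3 : (mulForm G).lTensor A (S.rTensor B z) = (mulForm G).flip.lTensor A z := by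
      rw [← LinearMap.comp_apply, LinearMap.lTensor_comp_rTensor]
      exact hSG
    rw [hSz] at h3
    rw [stabMap, one_smul, LinearMap.lTensor_sub, LinearMap.sub_apply, h3, sub_self]
  let πA : A →ₗ[ℂ] A := ∑ i, ((mulForm F).flip (v i)).smulRight (u i)
  let πB : B →ₗ[ℂ] B := ∑ j, ((mulForm G).flip (v' j)).smulRight (u' j)
  have hπA : ∀ x, πA x = ∑ i, F (x * v i) • u i := by
    intro x
    simp [πA]
  have hπB : ∀ x, πB x = ∑ i, G (x * v' i) • u' i := by
    intro x
    simp [πB]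
  have hAz : πA.rTensor B z = z := by
    obtain ⟨g, hg⟩ := exists_comp_eq_of_ker_le (f := S - 1) (g := πA - LinearMap.id) (by
      intro a ha
      rw [LinearMap.mem_ker, hS1] at ha
      simp [hπA, huv a ha])
    have h1 : (πA - LinearMap.id).rTensor B z = 0 := by
      have h2 : (S - 1).rTensor B z = 0 := by
        rw [LinearMap.rTensor_sub, LinearMap.sub_apply, hSz, Module.End.one_eq_id,
          LinearMap.rTensor_id, LinearMap.id_apply, sub_self]
      rw [hg, LinearMap.rTensor_comp, LinearMap.comp_apply, h2, map_zero]
    rwa [LinearMap.rTensor_sub, LinearMap.sub_apply, LinearMap.rTensor_id, LinearMap.id_apply,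
      sub_eq_zero] at h1
  have hBz : πB.lTensor A z = z := by
    obtain ⟨g, hg⟩ := exists_comp_eq_of_ker_le (f := stabMap 1 G) (g := πB - LinearMap.id) (by
      intro a ha
      rw [ker_stabMap] at ha
      simp [hπB, huv' a ha])
    have h1 : (πB - LinearMap.id).lTensor A z = 0 := by
      rw [hg, LinearMap.lTensor_comp, LinearMap.comp_apply, hGz, map_zero]
    rwa [LinearMap.lTensor_sub, LinearMap.sub_apply, LinearMap.lTensor_id, LinearMap.id_apply,
      sub_eq_zero] at h1
  have hmap : ∀ w : A ⊗[ℂ] B, TensorProduct.map πA πB w =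
      ∑ i, ∑ j, tensorDual F G (w * v i ⊗ₜ v' j) • u i ⊗ₜ[ℂ] u' j := by
    intro w
    induction w with
    | zero => simp
    | add x y hx hy =>
      simp only [map_add, hx, hy, add_mul, add_smul, Finset.sum_add_distrib]
    | tmul a b =>
      rw [TensorProduct.map_tmul, hπA, hπB, TensorProduct.sum_tmul]
      refine Finset.sum_congr rfl fun i _ => ?_
      rw [TensorProduct.tmul_sum]
      refine Finset.sum_congr rfl fun j _ => ?_
      rw [TensorProduct.smul_tmul_smul, Algebra.TensorProduct.tmul_mul_tmul, tensorDual_tmul]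
  rw [← hmap, ← LinearMap.lTensor_comp_rTensor, LinearMap.comp_apply, hAz, hBz]

/-- The disjointness condition makes the stabilizer of `F ⊗ G` the product of stabilizers. -/
theorem tensorDual_properties {F : Module.Dual ℂ A} {G : Module.Dual ℂ B}
    (hF : NondegOnStab F) (hG : NondegOnStab G) (hF0 : Stab F 0 = ⊥)
    (hFG : ∀ α : ℂ, α ≠ 1 → Stab F α = ⊥ ∨ Stab G α⁻¹ = ⊥)
    (hFc : ∀ a ∈ Stab F 1, ∀ b ∈ Stab F 1, a * b = b * a)
    (hGc : ∀ a ∈ Stab G 1, ∀ b ∈ Stab G 1, a * b = b * a) :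
    NondegOnStab (tensorDual F G) ∧
      (∀ a ∈ Stab (tensorDual F G) 1, ∀ b ∈ Stab (tensorDual F G) 1, a * b = b * a) ∧
      Module.finrank ℂ (Stab (tensorDual F G) 1) =
        Module.finrank ℂ (Stab F 1) * Module.finrank ℂ (Stab G 1) := by
  obtain ⟨u, v, hu, hv, huv⟩ := hF.exists_dual_bases
  obtain ⟨u', v', hu', hv', huv'⟩ := hG.exists_dual_bases
  have key := fun z (hz : z ∈ Stab (tensorDual F G) 1) =>
    eq_sum_of_mem_Stab_tensorDual hF hF0 hFG huv huv' hz
  refine ⟨fun z hz h => ?_, fun z hz w hw => ?_, ?_⟩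
  · rw [key z hz]
    simp [h _ (tmul_mem_Stab_tensorDual (hv _) (hv' _))]
  · rw [key z hz, key w hw]
    refine Commute.sum_left _ _ _ fun i _ => Commute.sum_left _ _ _ fun j _ =>
      Commute.sum_right _ _ _ fun k _ => Commute.sum_right _ _ _ fun m _ =>
        (Commute.smul_right ?_ _).smul_left _
    exact Commute.tmul (hFc _ (hu i) _ (hu k)) (hGc _ (hu' j) _ (hu' m))
  · let f := TensorProduct.map (Stab F 1).subtype (Stab G 1).subtype
    have hf : Function.Injective f := TensorProduct.map_injective_of_flat_flat _ _
      (Submodule.subtype_injective _) (Submodule.subtype_injective _)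
    have hr : LinearMap.range f = Stab (tensorDual F G) 1 := by
      apply le_antisymm
      · rintro _ ⟨t, rfl⟩
        induction t with
        | zero => simp
        | add x y hx hy => rw [map_add]; exact add_mem hx hy
        | tmul a b => exact tmul_mem_Stab_tensorDual a.2 b.2
      · intro z hz
        rw [key z hz]
        refine sum_mem fun i _ => sum_mem fun j _ => Submodule.smul_mem _ _ ?_
        exact ⟨⟨u i, hu i⟩ ⊗ₜ ⟨u' j, hu' j⟩, rfl⟩
    rw [← hr, LinearMap.finrank_range_of_inj hf, Module.finrank_tensorProduct]

end Tensor

/-! ### Generic choices and the index theorem. -/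

theorem dense_biInter_of_finite {X ι : Type*} [TopologicalSpace X] {s : Set ι} (hs : s.Finite)
    {f : ι → Set X} (ho : ∀ i ∈ s, IsOpen (f i)) (hd : ∀ i ∈ s, Dense (f i)) :
    Dense (⋂ i ∈ s, f i) := by
  induction s, hs using Set.Finite.induction_on with
  | empty => simp
  | insert _ _ ih =>
    rw [Set.biInter_insert]
    exact (hd _ (Set.mem_insert _ _)).inter_of_isOpen_left
      (ih (fun i hi => ho i (Set.mem_insert_of_mem _ hi))
        fun i hi => hd i (Set.mem_insert_of_mem _ hi)) (ho _ (Set.mem_insert _ _))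

section Index

attribute [local instance] dualTopology

/-- One regular functional, nondegenerate on its stabilizer, makes the algebra of type 1 and
`1`-precise. -/
theorem isPreciseAlgebra_of_nondegOnStab {A : Type*} [NonUnitalRing A] [Module ℂ A]
    [SMulCommClass ℂ A A] [IsScalarTower ℂ A A] [FiniteDimensional ℂ A] {F : Module.Dual ℂ A}
    (hF : NondegOnStab F) (hreg : IsRegular 1 F) :
    IsType1 A ∧ IsPreciseAlgebra A 1 := by
  have hc := hF.coeff_ne_zero
  have hp : ∀ G ∈ {G : Module.Dual ℂ A |
      (dehomogenize (charPoly G)).coeff (Module.finrank ℂ (Stab F 1)) ≠ 0}, IsPrecise 1 G :=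
    fun G hG => isPrecise_of_coeff_ne_zero (hreg.finrank_le A G) hG
  exact ⟨⟨_, isOpen_coeff_ne_zero A _, ⟨F, hc⟩, fun G hG => (hp G hG).charPoly_ne_zero⟩,
    ⟨_, isOpen_coeff_ne_zero A _, dense_coeff_ne_zero A hc, hp⟩⟩

/-- Every dense set of functionals contains a `1`-regular one. -/
theorem exists_isRegular_mem {A : Type*} [NonUnitalRing A] [Module ℂ A]
    [SMulCommClass ℂ A A] [IsScalarTower ℂ A A] [FiniteDimensional ℂ A]
    {U : Set (Module.Dual ℂ A)} (hU : Dense U) : ∃ F ∈ U, IsRegular 1 F := by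
  obtain ⟨F, hF, hFU⟩ := hU.inter_open_nonempty _ (isOpen_setOf_isRegular (A := A) 1)
    (exists_isRegular A 1)
  exact ⟨F, hFU, hF⟩

theorem RootsDependNontrivially.dense_Stab_eq_bot {A : Type*} [NonUnitalRing A] [Module ℂ A]
    [SMulCommClass ℂ A A] [IsScalarTower ℂ A A] [FiniteDimensional ℂ A]
    (h : RootsDependNontrivially A) {α : ℂ} (hα : α ≠ 1) :
    Dense {F : Module.Dual ℂ A | Stab F α = ⊥} := by
  rw [dense_iff_inter_open]
  intro U hU hne
  by_contra hcon
  apply hα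
  have := h (α : OnePoint ℂ) U hU hne fun F hF => isCharRoot_coe_iff.mpr fun h0 => hcon ⟨F, hF, h0⟩
  exact_mod_cast this

end Index

end AssocIndex

end

theorem mainTheorem1
    (A B : Type*)
    [NonUnitalRing A] [Module ℂ A] [SMulCommClass ℂ A A] [IsScalarTower ℂ A A]
    [FiniteDimensional ℂ A]
    [NonUnitalRing B] [Module ℂ B] [SMulCommClass ℂ B B] [IsScalarTower ℂ B B]
    [FiniteDimensional ℂ B]
    (hA : AssocIndex.IsType1 A) (hB : AssocIndex.IsType1 B)
    (hA1 : AssocIndex.IsPreciseAlgebra A 1) (hB1 : AssocIndex.IsPreciseAlgebra B 1)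
    (hroots : AssocIndex.RootsDependNontrivially A) :
    AssocIndex.IsType1 (A ⊗[ℂ] B) ∧ AssocIndex.IsPreciseAlgebra (A ⊗[ℂ] B) 1 ∧
      AssocIndex.index (A ⊗[ℂ] B) = AssocIndex.index A * AssocIndex.index B := by
  let _ := AssocIndex.dualTopology A
  obtain ⟨UA, hUAo, hUAd, hUA⟩ := hA1
  obtain ⟨UB, -, hUBd, hUB⟩ := hB1
  obtain ⟨G, hGU, hGreg⟩ := AssocIndex.exists_isRegular_mem hUBd
  have hGp := hUB G hGU
  -- These are the values that `F` must avoid as roots. Including `0` makes `F(xy)` nondegenerate,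
  -- and renders the convention `0⁻¹ = 0` harmless.
  have hfin : (insert 0 {α : ℂ | α ≠ 1 ∧ AssocIndex.Stab G α⁻¹ ≠ ⊥}).Finite := by
    refine Set.Finite.insert _ ((hGp.finite_roots.preimage
      (inv_injective.injOn : Set.InjOn (fun α : ℂ => α⁻¹) _)).subset ?_)
    exact fun α hα => hα.2
  have hopen : ∀ α, IsOpen {F : Module.Dual ℂ A | AssocIndex.Stab F α = ⊥} :=
    AssocIndex.isOpen_Stab_eq_bot
  have hdense : Dense (⋂ α ∈ insert 0 {α : ℂ | α ≠ 1 ∧ AssocIndex.Stab G α⁻¹ ≠ ⊥},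
      {F : Module.Dual ℂ A | AssocIndex.Stab F α = ⊥}) := by
    refine AssocIndex.dense_biInter_of_finite hfin (fun α _ => hopen α) fun α hα => ?_
    refine hroots.dense_Stab_eq_bot ?_
    rcases hα with rfl | hα
    · exact zero_ne_one
    · exact hα.1
  obtain ⟨F, ⟨hFU, hFroots⟩, hFreg⟩ :=
    AssocIndex.exists_isRegular_mem (hUAd.inter_of_isOpen_left hdense hUAo)
  have hFroot : ∀ α ∈ insert 0 {α : ℂ | α ≠ 1 ∧ AssocIndex.Stab G α⁻¹ ≠ ⊥},
      AssocIndex.Stab F α = ⊥ := fun α hα => Set.mem_iInter₂.mp hFroots α hα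
  obtain ⟨hnd, hcomm, hrank⟩ := AssocIndex.tensorDual_properties (hUA F hFU).nondegOnStab
    hGp.nondegOnStab (hFroot 0 (Set.mem_insert _ _))
    (fun α hα => or_iff_not_imp_right.mpr fun h => hFroot α (Set.mem_insert_of_mem _ ⟨hα, h⟩))
    (fun a ha b hb => hFreg.commute ha hb) (fun a ha b hb => hGreg.commute ha hb)
  have hreg := hnd.isRegular hcomm
  obtain ⟨h1, h2⟩ := AssocIndex.isPreciseAlgebra_of_nondegOnStab hnd hreg
  refine ⟨h1, h2, ?_⟩
  rw [← hreg.finrank_eq_index, hrank, hFreg.finrank_eq_index, hGreg.finrank_eq_index]
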